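/- Let $F$ be a continuous cumulative distribution function on $\mathbb{R}$. For a sample $x_1,\dots,x_n$ ($n\ge 1$) with order statistics $x_{(1)}\le\dots\le x_{(n)}$ put $u_{(i)}=F(x_{(i)})$ and $$p_{(i)}=\Pr[\mathrm{Beta}(i,n-i+1)<u_{(i)}],\qquad 1\le i\le n,$$ and define $$M_n^+=\min_{1\le i\le n}p_{(i)},\qquad M_n^-=\min_{1\le i\le n}(1-p_{(i)}),\qquad M_n=\min\{M_n^+,M_n^-\}.$$ Let $\mathcal H_0$ denote the null hypothesis that the observations are i.i.d. with distribution function $F$. For any $c\in[0,1]$ let $q_c=q_{c,n}=\Pr[M_n^+\le c\mid\mathcal H_0]$. Then for every $n\ge 1$ $$2q_c-q_c^2\ \le\ \Pr[M_n\le c\mid\mathcal H_0]\ \le\ 2q_c.$$ Furthermore, for every fixed $c\in[0,1]$, $$\Pr[M_n\le c\mid\mathcal H_0]-\bigl(2q_{c,n}-q_{c,n}^2\bigr)\longrightarrow 0\qquad\text{as } n\to\infty .$$ -/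

import Mathlib

open MeasureTheory ProbabilityTheory Filter Topology

noncomputable section

namespace BerkJones

/-- The order statistics of a sample `x`: `orderStat x k` is the `(k+1)`-th smallest observation
(indices in `Fin n` start at `0`), so `orderStat x` is the nondecreasing rearrangement of `x`. -/
def orderStat {n : ℕ} (x : Fin n → ℝ) (k : Fin n) : ℝ :=
  x (Tuple.sort x k)

/-- The one-sided p-value `p_(i) = Pr[Beta(i, n - i + 1) < F(x_(i))]` of the `i`-th order
statistic, where `i = k + 1`, so that `n - i + 1 = n - k`. -/
def pValue {n : ℕ} (F : ℝ → ℝ) (x : Fin n → ℝ) (k : Fin n) : ℝ :=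
  (betaMeasure ((k : ℝ) + 1) ((n : ℝ) - (k : ℝ))).real (Set.Iio (F (orderStat x k)))

/-- `M_n^+ = min_i p_(i)`; the infimum is over a finite index set, nonempty when `1 ≤ n`. -/
def Mplus {n : ℕ} (F : ℝ → ℝ) (x : Fin n → ℝ) : ℝ :=
  ⨅ k : Fin n, pValue F x k

/-- `M_n^- = min_i (1 - p_(i))`. -/
def Mminus {n : ℕ} (F : ℝ → ℝ) (x : Fin n → ℝ) : ℝ :=
  ⨅ k : Fin n, (1 - pValue F x k)

/-- The two-sided exact Berk-Jones statistic `M_n = min {M_n^+, M_n^-}`. -/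
def M {n : ℕ} (F : ℝ → ℝ) (x : Fin n → ℝ) : ℝ :=
  min (Mplus F x) (Mminus F x)

/-- The null hypothesis for a sample `X` of size `n`: the observations are independent and each
has law `ν`. -/
structure NullSample {Ω : Type*} [MeasurableSpace Ω] {n : ℕ} (ν : Measure ℝ)
    (P : Measure Ω) (X : Fin n → Ω → ℝ) : Prop where
  hasLaw : ∀ i, HasLaw (X i) ν P
  indep : iIndepFun X P

end BerkJones

end

/-!
The transform `F` makes the observations uniform, and reflecting the uniform sample exchanges `M⁺`
and `M⁻`, so both one-sided statistics are at most `c` with the same probability `q`. As `{M⁺ ≤ c}`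
is decreasing and `{M⁻ ≤ c}` increasing in the sample, Harris' inequality bounds the probability of
their intersection by `q ^ 2`, and inclusion-exclusion gives both bounds.

Consequently the defect `Pr[M ≤ c] - (2 * q - q ^ 2)` lies between `0` and `(1 - q) ^ 2`. For
`c = 0` we have `q = 0`, and for `c > 0` we have `q → 1`: by Chebyshev's inequality for the beta
distribution, `M⁺ ≤ c` as soon as, for some `t`, at least `n * t + C * √(n * t)` observations are
below `t`. Along the scales `t = r, r ^ 2, …, r ^ K` with `r` small this is governed by the counts
in the disjoint windows `(r * t, t]`. Each of these falls short with probability at most some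
`φ < 1` in the limit, by the central limit theorem, and they are negatively dependent, so all fall
short with probability at most `φ ^ K`.
-/

open scoped ENNReal

noncomputable section

namespace BerkJones

section Association

theorem mul_add_mul_le_of_canonicallyOrdered {R : Type*} [CommSemiring R] [PartialOrder R]
    [CanonicallyOrderedAdd R] {a b c d : R} (hab : a ≤ b) (hcd : c ≤ d) :
    a * d + b * c ≤ a * c + b * d := by
  obtain ⟨s, rfl⟩ := exists_add_of_le hab
  obtain ⟨t, rfl⟩ := exists_add_of_le hcd
  exact le_iff_exists_add.2 ⟨s * t, by ring⟩

theorem mul_add_mul_le_of_monovary {α : Type*} {f g : α → ℝ≥0∞} (h : Monovary f g) (x y : α) :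
    f x * g y + f y * g x ≤ f x * g x + f y * g y := by
  rcases lt_trichotomy (g x) (g y) with hg | hg | hg
  · exact mul_add_mul_le_of_canonicallyOrdered (h hg) hg.le
  · rw [hg]
  · rw [add_comm, add_comm (f x * g x)]
    exact mul_add_mul_le_of_canonicallyOrdered (h hg) hg.le

theorem mul_add_mul_le_of_antivary {α : Type*} {f g : α → ℝ≥0∞} (h : Antivary f g) (x y : α) :
    f x * g x + f y * g y ≤ f x * g y + f y * g x := by
  rcases lt_trichotomy (g x) (g y) with hg | hg | hg
  · rw [add_comm, add_comm (f x * g y)]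
    exact mul_add_mul_le_of_canonicallyOrdered (h hg) hg.le
  · rw [hg]
  · exact mul_add_mul_le_of_canonicallyOrdered (h hg) hg.le

variable {α : Type*} [MeasurableSpace α] {μ : Measure α} {f g : α → ℝ≥0∞}

theorem lintegral_lintegral_mul_add_mul_swap (hf : Measurable f) (hg : Measurable g) :
    ∫⁻ x, ∫⁻ y, f x * g y + f y * g x ∂μ ∂μ = 2 * ((∫⁻ x, f x ∂μ) * ∫⁻ x, g x ∂μ) := by
  have hinner (x : α) :
      ∫⁻ y, f x * g y + f y * g x ∂μ = f x * ∫⁻ y, g y ∂μ + (∫⁻ y, f y ∂μ) * g x := by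
    rw [lintegral_add_left (hg.const_mul _), lintegral_const_mul _ hg, lintegral_mul_const _ hf]
  simp only [hinner]
  rw [lintegral_add_left (hf.mul_const _), lintegral_mul_const _ hf, lintegral_const_mul _ hg,
    two_mul]

variable [IsProbabilityMeasure μ]

theorem lintegral_lintegral_mul_add_mul_diag (hf : Measurable f) (hg : Measurable g) :
    ∫⁻ x, ∫⁻ y, f x * g x + f y * g y ∂μ ∂μ = 2 * ∫⁻ x, f x * g x ∂μ := by
  simp only [lintegral_add_left measurable_const, lintegral_const, measure_univ, mul_one]
  rw [lintegral_add_left (hf.fun_mul hg), lintegral_const, measure_univ, mul_one, two_mul]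

theorem lintegral_mul_lintegral_le_of_monovary (hf : Measurable f) (hg : Measurable g)
    (h : Monovary f g) :
    (∫⁻ x, f x ∂μ) * ∫⁻ x, g x ∂μ ≤ ∫⁻ x, f x * g x ∂μ := by
  refine (ENNReal.mul_le_mul_iff_right two_ne_zero ENNReal.ofNat_ne_top).1 ?_
  rw [← lintegral_lintegral_mul_add_mul_swap hf hg, ← lintegral_lintegral_mul_add_mul_diag hf hg]
  exact lintegral_mono fun x => lintegral_mono fun y => mul_add_mul_le_of_monovary h x y

theorem lintegral_mul_le_of_antivary (hf : Measurable f) (hg : Measurable g) (h : Antivary f g) :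
    ∫⁻ x, f x * g x ∂μ ≤ (∫⁻ x, f x ∂μ) * ∫⁻ x, g x ∂μ := by
  refine (ENNReal.mul_le_mul_iff_right two_ne_zero ENNReal.ofNat_ne_top).1 ?_
  rw [← lintegral_lintegral_mul_add_mul_swap hf hg, ← lintegral_lintegral_mul_add_mul_diag hf hg]
  exact lintegral_mono fun x => lintegral_mono fun y => mul_add_mul_le_of_antivary h x y

end Association

/-- Positive association in the sense of Esary, Proschan and Walkup: increasing functions are
positively correlated. Stating it for `ℝ≥0∞`-valued functions avoids integrability conditions. -/
def PositivelyAssociated {α : Type*} [MeasurableSpace α] [Preorder α] (μ : Measure α) : Prop :=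
  ∀ ⦃f g : α → ℝ≥0∞⦄, Measurable f → Measurable g → Monotone f → Monotone g →
    (∫⁻ x, f x ∂μ) * ∫⁻ x, g x ∂μ ≤ ∫⁻ x, f x * g x ∂μ

namespace PositivelyAssociated

variable {α β : Type*} [MeasurableSpace α] [MeasurableSpace β] {μ : Measure α} {ν : Measure β}

theorem of_linearOrder [LinearOrder α] [IsProbabilityMeasure μ] : PositivelyAssociated μ :=
  fun _ _ hf hg hf' hg' => lintegral_mul_lintegral_le_of_monovary hf hg (hf'.monovary hg')

theorem of_subsingleton [Preorder α] [Subsingleton α] [IsProbabilityMeasure μ] :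
    PositivelyAssociated μ :=
  fun _ g hf hg _ _ => lintegral_mul_lintegral_le_of_monovary hf hg
    fun x y h => absurd (congrArg g (Subsingleton.elim x y)) h.ne

theorem map [Preorder α] [Preorder β] (hμ : PositivelyAssociated μ) {φ : α → β}
    (hφ : Measurable φ) (hφ' : Monotone φ) : PositivelyAssociated (μ.map φ) := by
  intro f g hf hg hf' hg'
  rw [lintegral_map hf hφ, lintegral_map hg hφ, lintegral_map (hf.fun_mul hg) hφ]
  exact hμ (hf.comp hφ) (hg.comp hφ) (hf'.comp hφ') (hg'.comp hφ')

theorem prod [Preorder α] [Preorder β] [SFinite ν] (hμ : PositivelyAssociated μ)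
    (hν : PositivelyAssociated ν) : PositivelyAssociated (μ.prod ν) := by
  intro f g hf hg hf' hg'
  rw [lintegral_prod _ hf.aemeasurable, lintegral_prod _ hg.aemeasurable,
    lintegral_prod _ (hf.fun_mul hg).aemeasurable]
  calc (∫⁻ x, ∫⁻ y, f (x, y) ∂ν ∂μ) * ∫⁻ x, ∫⁻ y, g (x, y) ∂ν ∂μ
      ≤ ∫⁻ x, (∫⁻ y, f (x, y) ∂ν) * ∫⁻ y, g (x, y) ∂ν ∂μ :=
        hμ hf.lintegral_prod_right' hg.lintegral_prod_right'
          (fun _ _ h => lintegral_mono fun _ => hf' (Prod.mk_le_mk.2 ⟨h, le_rfl⟩))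
          fun _ _ h => lintegral_mono fun _ => hg' (Prod.mk_le_mk.2 ⟨h, le_rfl⟩)
    _ ≤ ∫⁻ x, ∫⁻ y, f (x, y) * g (x, y) ∂ν ∂μ := lintegral_mono fun x =>
        hν (hf.comp measurable_prodMk_left) (hg.comp measurable_prodMk_left)
          (fun _ _ h => hf' (Prod.mk_le_mk.2 ⟨le_rfl, h⟩))
          fun _ _ h => hg' (Prod.mk_le_mk.2 ⟨le_rfl, h⟩)

theorem pi [Preorder α] [IsProbabilityMeasure μ] (hμ : PositivelyAssociated μ) (n : ℕ) :
    PositivelyAssociated (Measure.pi fun _ : Fin n => μ) := by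
  induction n with
  | zero => exact of_subsingleton
  | succ n ih =>
    have e := (measurePreserving_piFinSuccAbove (fun _ : Fin (n + 1) => μ) 0).symm
    rw [← e.map_eq]
    refine (hμ.prod ih).map e.measurable fun x y h => ?_
    simpa [MeasurableEquiv.piFinSuccAbove_symm_apply, Fin.consEquiv] using
      Fin.cons_le_cons.2 ⟨h.1, h.2⟩

theorem measureReal_inter_le [Preorder α] [IsProbabilityMeasure μ] (hμ : PositivelyAssociated μ)
    {s t : Set α} (hs : IsLowerSet s) (ht : IsUpperSet t) (hsm : MeasurableSet s)
    (htm : MeasurableSet t) : μ.real (s ∩ t) ≤ μ.real s * μ.real t := by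
  have mono {u : Set α} (hu : IsUpperSet u) : Monotone (u.indicator (1 : α → ℝ≥0∞)) := by
    intro x y h
    by_cases hx : x ∈ u
    · simp [hx, hu h hx]
    · simp [hx]
  have h := hμ (measurable_one.indicator hsm.compl) (measurable_one.indicator htm)
    (mono hs.compl) (mono ht)
  have hmul (x : α) : sᶜ.indicator (1 : α → ℝ≥0∞) x * t.indicator 1 x =
      (sᶜ ∩ t).indicator 1 x := by
    rw [Set.inter_indicator_one, Pi.mul_apply]
  simp only [hmul] at h
  rw [lintegral_indicator_one hsm.compl, lintegral_indicator_one htm,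
    lintegral_indicator_one (hsm.compl.inter htm)] at h
  have hreal : (1 - μ.real s) * μ.real t ≤ μ.real (sᶜ ∩ t) := by
    rw [← probReal_compl_eq_one_sub hsm, measureReal_def, measureReal_def, measureReal_def,
      ← ENNReal.toReal_mul]
    exact ENNReal.toReal_mono (measure_ne_top _ _) h
  have hsplit : μ.real (s ∩ t) + μ.real (sᶜ ∩ t) = μ.real t := by
    rw [Set.inter_comm s, Set.inter_comm sᶜ, ← Set.sdiff_eq]
    exact measureReal_inter_add_sdiff hsm
  linarith

end PositivelyAssociated

section Count

variable {α : Type*} {n : ℕ}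

/-- The number of observations of the sample `x` that lie in `s`. It is real-valued because it is
compared with `n` times a probability. -/
def count (s : Set α) (x : Fin n → α) : ℝ :=
  ∑ i, s.indicator 1 (x i)

theorem count_eq_card (s : Set α) [DecidablePred (· ∈ s)] (x : Fin n → α) :
    count s x = Fintype.card {i // x i ∈ s} := by
  simp [count, Set.indicator_apply, Fintype.card_subtype]

theorem count_cons (s : Set α) (a : α) (x : Fin n → α) :
    count s (Fin.cons a x : Fin (n + 1) → α) = s.indicator 1 a + count s x := by
  simp only [count, Fin.sum_univ_succ, Fin.cons_zero, Fin.cons_succ]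

theorem count_union {s t : Set α} (h : Disjoint s t) (x : Fin n → α) :
    count (s ∪ t) x = count s x + count t x := by
  simp only [count, Set.indicator_union_of_disjoint h, Finset.sum_add_distrib]

theorem count_le_count {s t : Set α} {x y : Fin n → α} (h : ∀ i, x i ∈ s → y i ∈ t) :
    count s x ≤ count t y := by
  refine Finset.sum_le_sum fun i _ => ?_
  by_cases hi : x i ∈ s
  · simp [hi, h i hi]
  · simpa [hi] using Set.indicator_apply_nonneg (a := y i) fun _ => zero_le_one (α := ℝ)

@[fun_prop]
theorem measurable_count [MeasurableSpace α] {s : Set α} (hs : MeasurableSet s) :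
    Measurable (count s : (Fin n → α) → ℝ) :=
  Finset.measurable_fun_sum _ fun i _ => (measurable_one.indicator hs).comp (measurable_pi_apply i)

end Count

section NegativeDependence

variable {α ι : Type*} [MeasurableSpace α] {μ : Measure α} [IsProbabilityMeasure μ]

-- Where one of the functions drops below its maximum, all the others are at theirs.
theorem lintegral_prod_le_prod_lintegral_of_disjoint (s : Finset ι) {I : ι → Set α}
    (hI : Pairwise (Function.onFun Disjoint I)) {g : ι → α → ℝ≥0∞} (hg : ∀ j, Measurable (g j))
    {b : ι → ℝ≥0∞} (hgb : ∀ j a, g j a ≤ b j) (hgI : ∀ j, ∀ a ∉ I j, g j a = b j) :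
    ∫⁻ a, ∏ j ∈ s, g j a ∂μ ≤ ∏ j ∈ s, ∫⁻ a, g j a ∂μ := by
  classical
  induction s using Finset.induction_on with
  | empty => simp
  | insert k s hk ih =>
    simp only [Finset.prod_insert hk]
    refine (lintegral_mul_le_of_antivary (hg k) (Finset.measurable_fun_prod s fun j _ => hg j)
      fun x y hxy => ?_).trans (mul_le_mul_right ih _)
    obtain ⟨j, hj, hxj⟩ : ∃ j ∈ s, x ∈ I j := by
      by_contra! h
      refine hxy.not_ge (Finset.prod_le_prod' fun j hj => ?_)
      exact (hgb j y).trans_eq (hgI j x (h j hj)).symm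
    have hxk : x ∉ I k := fun h =>
      Set.disjoint_left.1 (hI (ne_of_mem_of_not_mem hj hk)) hxj h
    exact (hgb k y).trans_eq (hgI k x hxk).symm

theorem lintegral_pi_succ {n : ℕ} {f : (Fin (n + 1) → α) → ℝ≥0∞} (hf : Measurable f) :
    ∫⁻ x, f x ∂(Measure.pi fun _ => μ) =
      ∫⁻ a, ∫⁻ x : Fin n → α, f (Fin.cons a x) ∂(Measure.pi fun _ => μ) ∂μ := by
  have e := (measurePreserving_piFinSuccAbove (fun _ : Fin (n + 1) => μ) 0).symm
  rw [← e.lintegral_comp hf, lintegral_prod _ (by exact (hf.comp e.measurable).aemeasurable)]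
  simp [MeasurableEquiv.piFinSuccAbove_symm_apply, Fin.consEquiv]

variable [Fintype ι] {n : ℕ}

theorem lintegral_prod_count_le {I : ι → Set α} (hIm : ∀ j, MeasurableSet (I j))
    (hI : Pairwise (Function.onFun Disjoint I)) {f : ι → ℝ → ℝ≥0∞} (hf : ∀ j, Antitone (f j)) :
    ∫⁻ x : Fin n → α, ∏ j, f j (count (I j) x) ∂(Measure.pi fun _ => μ) ≤
      ∏ j, ∫⁻ x : Fin n → α, f j (count (I j) x) ∂(Measure.pi fun _ => μ) := by
  have hfm (j : ι) (m : ℕ) : Measurable fun x : Fin m → α => f j (count (I j) x) :=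
    (hf j).measurable.comp (measurable_count (hIm j))
  induction n generalizing f with
  | zero => simp [count]
  | succ n ih =>
    let H (j : ι) (ε : ℝ) : ℝ≥0∞ :=
      ∫⁻ x : Fin n → α, f j (ε + count (I j) x) ∂(Measure.pi fun _ => μ)
    have hH (j : ι) : Antitone (H j) := fun ε ε' h =>
      lintegral_mono fun x => hf j (add_le_add_left h _)
    have hshift (j : ι) (ε : ℝ) : Antitone fun t => f j (ε + t) :=
      fun s t h => hf j (add_le_add_right h _)
    rw [lintegral_pi_succ (Finset.measurable_fun_prod _ fun j _ => hfm j _)]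
    simp only [lintegral_pi_succ (hfm _ _), count_cons]
    calc ∫⁻ a, ∫⁻ x : Fin n → α, ∏ j, f j ((I j).indicator 1 a + count (I j) x)
          ∂(Measure.pi fun _ => μ) ∂μ
        ≤ ∫⁻ a, ∏ j, H j ((I j).indicator 1 a) ∂μ := lintegral_mono fun a =>
          ih (fun j => hshift j _) fun j m =>
            (hshift j _).measurable.comp (measurable_count (hIm j))
      _ ≤ ∏ j, ∫⁻ a, H j ((I j).indicator 1 a) ∂μ :=
          lintegral_prod_le_prod_lintegral_of_disjoint Finset.univ hI (b := fun j => H j 0)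
            (fun j => (hH j).measurable.comp (measurable_one.indicator (hIm j)))
            (fun j a => hH j (Set.indicator_nonneg (fun _ _ => zero_le_one) a))
            fun j a ha => by rw [Set.indicator_of_notMem ha]

theorem measureReal_forall_count_lt_le {I : ι → Set α} (hIm : ∀ j, MeasurableSet (I j))
    (hI : Pairwise (Function.onFun Disjoint I)) (k : ι → ℝ) :
    (Measure.pi fun _ => μ).real {x : Fin n → α | ∀ j, count (I j) x < k j} ≤
      ∏ j, (Measure.pi fun _ => μ).real {x : Fin n → α | count (I j) x < k j} := by
  have hm (j : ι) : MeasurableSet {x : Fin n → α | count (I j) x < k j} :=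
    measurableSet_lt (measurable_count (hIm j)) measurable_const
  have hanti (j : ι) : Antitone ((Set.Iio (k j)).indicator (1 : ℝ → ℝ≥0∞)) := by
    intro s t h
    by_cases ht : t < k j
    · simp [ht, h.trans_lt ht]
    · simp [ht]
  have h := lintegral_prod_count_le (μ := μ) (n := n) hIm hI hanti
  have hone (j : ι) (x : Fin n → α) : (Set.Iio (k j)).indicator (1 : ℝ → ℝ≥0∞) (count (I j) x) =
      {x : Fin n → α | count (I j) x < k j}.indicator 1 x := rfl
  have hall (x : Fin n → α) :
      ∏ j, {x : Fin n → α | count (I j) x < k j}.indicator (1 : (Fin n → α) → ℝ≥0∞) x =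
        {x : Fin n → α | ∀ j, count (I j) x < k j}.indicator 1 x := by
    simp [Set.indicator_apply, Finset.prod_ite_zero]
  simp only [hone, hall] at h
  rw [lintegral_indicator_one
    (by simpa only [Set.ofPred_forall] using MeasurableSet.iInter hm)] at h
  simp only [lintegral_indicator_one (hm _)] at h
  simp only [measureReal_def, ← ENNReal.toReal_prod]
  exact ENNReal.toReal_mono (ENNReal.prod_ne_top fun j _ => measure_ne_top _ _) h

end NegativeDependence

section LimitTheorems

variable {α : Type*} [MeasurableSpace α] {μ : Measure α} [IsProbabilityMeasure μ] {f : α → ℝ}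

theorem integral_pi_sum (hf : Integrable f μ) (n : ℕ) :
    ∫ x : Fin n → α, ∑ i, f (x i) ∂(Measure.pi fun _ => μ) = n * ∫ a, f a ∂μ := by
  rw [integral_finsetSum _ fun i _ => integrable_comp_eval hf]
  simp [integral_comp_eval (μ := fun _ : Fin n => μ) hf.aestronglyMeasurable]

theorem measureReal_pi_sum_le_sub (hf : MemLp f 2 μ) (n : ℕ) {c : ℝ} (hc : 0 < c) :
    (Measure.pi fun _ => μ).real {x : Fin n → α | ∑ i, f (x i) ≤ n * ∫ a, f a ∂μ - c} ≤
      n * Var[f; μ] / c ^ 2 := by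
  have hsum : MemLp (fun x : Fin n → α => ∑ i, f (x i)) 2 (Measure.pi fun _ => μ) :=
    memLp_finsetSum _ fun i _ => hf.comp_measurePreserving (measurePreserving_eval _ i)
  have hvar : Var[fun x : Fin n → α => ∑ i, f (x i); Measure.pi fun _ => μ] = n * Var[f; μ] := by
    simpa [Finset.sum_fn] using variance_sum_pi (μ := fun _ : Fin n => μ) fun _ => hf
  have h := meas_ge_le_variance_div_sq hsum hc
  rw [hvar, integral_pi_sum (hf.integrable one_le_two)] at h
  have hsub : {x : Fin n → α | ∑ i, f (x i) ≤ n * ∫ a, f a ∂μ - c} ⊆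
      {x | c ≤ |∑ i, f (x i) - n * ∫ a, f a ∂μ|} := by
    intro x hx
    rw [Set.mem_ofPred_eq] at hx ⊢
    exact le_abs.2 (.inr (by linarith))
  exact ENNReal.toReal_le_of_le_ofReal
    (div_nonneg (mul_nonneg n.cast_nonneg (variance_nonneg _ _)) (sq_nonneg c))
    ((measure_mono hsub).trans h)

theorem tendsto_measureReal_pi_inv_sqrt_mul_sum_lt (hf : Measurable f) (h0 : ∫ a, f a ∂μ = 0)
    (h1 : ∫ a, f a ^ 2 ∂μ = 1) (y : ℝ) :
    Tendsto (fun n : ℕ => (Measure.pi fun _ => μ).real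
        {x : Fin n → α | (√n)⁻¹ * ∑ i, f (x i) < y})
      atTop (𝓝 ((gaussianReal 0 1).real (Set.Iio y))) := by
  obtain ⟨Ω, _, P, X, hXm, hX, hindep, _⟩ := exists_iid ℕ μ
  have hmeas (n : ℕ) : Measurable fun x : Fin n → α => (√n)⁻¹ * ∑ i, f (x i) := by fun_prop
  have hlaw (n : ℕ) : HasLaw (fun ω (i : Fin n) => X i ω) (Measure.pi fun _ => μ) P :=
    (hindep.precomp Fin.val_injective).hasLaw_pi fun i => hX i
  have clt := tendstoInDistribution_inv_sqrt_mul_sum (P := P) (X := fun i => f ∘ X i)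
    (HasLaw.id (μ := gaussianReal 0 1))
    ((hX 0).integral_comp hf.aestronglyMeasurable |>.trans h0)
    ((hX 0).integral_comp (hf.pow_const 2).aestronglyMeasurable |>.trans h1)
    (hindep.comp _ fun _ => hf)
    fun i => ((hX i).identDistrib (hX 0)).comp hf
  have hlim := ProbabilityMeasure.tendsto_measure_of_null_frontier_of_tendsto' clt.tendsto
    (E := Set.Iio y) (by
      have := nullSingletonClass_gaussianReal (μ := 0) one_ne_zero
      simp)
  have heq (n : ℕ) : (P.map fun ω => (√n)⁻¹ * ∑ k ∈ Finset.range n, f (X k ω)) (Set.Iio y) =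
      (Measure.pi fun _ => μ) {x : Fin n → α | (√n)⁻¹ * ∑ i, f (x i) < y} := by
    rw [← (hlaw n).measure_eq (measurableSet_lt (hmeas n) measurable_const),
      Measure.map_apply (by fun_prop) measurableSet_Iio]
    simp only [Finset.sum_range]
    rfl
  simp only [ProbabilityMeasure.coe_mk, Measure.map_id, Function.comp_apply, heq] at hlim
  exact (ENNReal.tendsto_toReal (measure_ne_top _ _)).comp hlim

theorem tendsto_measureReal_pi_sum_lt (hf : MemLp f 2 μ) (hfm : Measurable f)
    (hv : Var[f; μ] ≠ 0) (y : ℝ) :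
    Tendsto (fun n : ℕ => (Measure.pi fun _ => μ).real
        {x : Fin n → α | ∑ i, f (x i) < n * ∫ a, f a ∂μ + y * √(n * Var[f; μ])})
      atTop (𝓝 ((gaussianReal 0 1).real (Set.Iio y))) := by
  have hσ : 0 < √Var[f; μ] := Real.sqrt_pos.2 ((variance_nonneg f μ).lt_of_ne' hv)
  let g (a : α) : ℝ := (f a - ∫ a, f a ∂μ) / √Var[f; μ]
  have hmean : ∫ a, g a ∂μ = 0 := by
    simp [g, integral_div, integral_sub (hf.integrable one_le_two) (integrable_const _)]
  have hsq : ∫ a, g a ^ 2 ∂μ = 1 := by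
    simp only [g, div_pow]
    rw [integral_div, Real.sq_sqrt (variance_nonneg f μ),
      ← variance_eq_integral hfm.aemeasurable, div_self hv]
  refine (tendsto_measureReal_pi_inv_sqrt_mul_sum_lt (f := g) (by fun_prop) hmean hsq
    y).congr' ?_
  filter_upwards [eventually_gt_atTop 0] with n hn
  have hn' : 0 < √(n : ℝ) := Real.sqrt_pos.2 (Nat.cast_pos.2 hn)
  congr 1
  ext x
  simp only [Set.mem_ofPred_eq, g]
  rw [← Finset.sum_div, Finset.sum_sub_distrib, Real.sqrt_mul n.cast_nonneg, inv_mul_lt_iff₀ hn',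
    div_lt_iff₀ hσ, sub_lt_iff_lt_add']
  simp [mul_assoc, mul_comm]

theorem gaussianReal_real_Iio_lt_one (m : ℝ) {v : NNReal} (hv : v ≠ 0) (y : ℝ) :
    (gaussianReal m v).real (Set.Iio y) < 1 := by
  have hpos : 0 < (gaussianReal m v).real (Set.Ici y) :=
    ENNReal.toReal_pos (fun h => by simpa using gaussianReal_absolutelyContinuous' m hv h)
      (measure_ne_top _ _)
  rw [← Set.compl_Ici, probReal_compl_eq_one_sub measurableSet_Ici]
  linarith

end LimitTheorems

section CountLimit

variable {α : Type*} [MeasurableSpace α] {μ : Measure α} [IsProbabilityMeasure μ] {s : Set α}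

theorem memLp_indicator_one (hs : MeasurableSet s) (p : ENNReal) :
    MemLp (s.indicator (1 : α → ℝ)) p μ :=
  (memLp_const (1 : ℝ)).indicator hs

theorem variance_indicator_one (hs : MeasurableSet s) :
    Var[s.indicator (1 : α → ℝ); μ] = μ.real s * (1 - μ.real s) := by
  have hsq : s.indicator (1 : α → ℝ) ^ 2 = s.indicator 1 := by
    rw [sq, ← Set.inter_indicator_one, Set.inter_self]
  rw [variance_eq_sub (memLp_indicator_one hs 2), hsq, integral_indicator_one hs]
  ring

theorem measureReal_count_le_sub (hs : MeasurableSet s) (n : ℕ) {c : ℝ} (hc : 0 < c) :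
    (Measure.pi fun _ => μ).real {x : Fin n → α | count s x ≤ n * μ.real s - c} ≤
      n * (μ.real s * (1 - μ.real s)) / c ^ 2 := by
  have h := measureReal_pi_sum_le_sub (memLp_indicator_one (μ := μ) hs 2) n hc
  rwa [integral_indicator_one hs, variance_indicator_one hs] at h

theorem tendsto_measureReal_count_lt (hs : MeasurableSet s) (h0 : 0 < μ.real s)
    (h1 : μ.real s < 1) (y : ℝ) :
    Tendsto (fun n : ℕ => (Measure.pi fun _ => μ).real {x : Fin n → α |
        count s x < n * μ.real s + y * √(n * (μ.real s * (1 - μ.real s)))})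
      atTop (𝓝 ((gaussianReal 0 1).real (Set.Iio y))) := by
  have h := tendsto_measureReal_pi_sum_lt (memLp_indicator_one (μ := μ) hs 2)
    (measurable_one.indicator hs)
    (by rw [variance_indicator_one hs]; exact (mul_pos h0 (sub_pos.2 h1)).ne') y
  rwa [integral_indicator_one hs, variance_indicator_one hs] at h

end CountLimit

section Beta

variable {α β : ℝ}

theorem beta_comm (α β : ℝ) : beta α β = beta β α := by
  simp only [beta, add_comm α β, mul_comm (Real.Gamma α)]

theorem beta_add_one_left (hα : 0 < α) (hβ : 0 < β) :
    beta (α + 1) β = α / (α + β) * beta α β := by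
  have hαβ := (add_pos hα hβ).ne'
  have hΓ := (Real.Gamma_pos_of_pos (add_pos hα hβ)).ne'
  simp only [beta, add_right_comm α 1 β, Real.Gamma_add_one hα.ne', Real.Gamma_add_one hαβ]
  field_simp

theorem measurable_betaPDF (α β : ℝ) : Measurable (betaPDF α β) :=
  (measurable_betaPDFReal α β).ennreal_ofReal

theorem betaPDF_one_sub (α β x : ℝ) : betaPDF α β (1 - x) = betaPDF β α x := by
  have h : (0 < 1 - x ∧ 1 - x < 1) ↔ (0 < x ∧ x < 1) := by
    rw [sub_pos, sub_lt_self_iff, and_comm]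
  simp only [betaPDF_eq, h, beta_comm α β, sub_sub_cancel]
  congr 2
  ring

theorem betaMeasure_Iio_one_sub (α β t : ℝ) :
    betaMeasure α β (Set.Iio (1 - t)) = betaMeasure β α (Set.Ioi t) := by
  rw [betaMeasure, betaMeasure, withDensity_apply _ measurableSet_Iio,
    withDensity_apply _ measurableSet_Ioi,
    ← (Measure.measurePreserving_sub_left volume 1).setLIntegral_comp_preimage_emb
      (measurableEmbedding_subLeft 1)]
  simp only [betaPDF_one_sub, Set.preimage_const_sub_Iio, sub_sub_cancel]

theorem betaMeasure_real_Iio_one_sub (hα : 0 < α) (hβ : 0 < β) (t : ℝ) :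
    (betaMeasure α β).real (Set.Iio (1 - t)) = 1 - (betaMeasure β α).real (Set.Iio t) := by
  have := isProbabilityMeasureBeta hβ hα
  have : NullSingletonClass (betaMeasure β α) := by unfold betaMeasure; infer_instance
  rw [measureReal_def, betaMeasure_Iio_one_sub, ← measureReal_def, ← Set.compl_Iic,
    probReal_compl_eq_one_sub measurableSet_Iic, measureReal_congr Iio_ae_eq_Iic]

theorem monotone_betaMeasure_real_Iio (hα : 0 < α) (hβ : 0 < β) :
    Monotone fun t => (betaMeasure α β).real (Set.Iio t) := by
  have := isProbabilityMeasureBeta hα hβ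
  exact fun s t h => measureReal_mono (Set.Iio_subset_Iio h)

theorem betaMeasure_real_Iio_pos (hα : 0 < α) (hβ : 0 < β) {t : ℝ} (ht : 0 < t) :
    0 < (betaMeasure α β).real (Set.Iio t) := by
  have := isProbabilityMeasureBeta hα hβ
  refine ENNReal.toReal_pos (fun h => ?_) (measure_ne_top _ _)
  rw [betaMeasure, withDensity_apply_eq_zero (measurable_betaPDF α β)] at h
  have hsub : Set.Ioo 0 (min t 1) ⊆ {x | betaPDF α β x ≠ 0} ∩ Set.Iio t := fun x hx =>
    have hx' := lt_min_iff.1 hx.2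
    ⟨(ENNReal.ofReal_pos.2 (betaPDFReal_pos hx.1 hx'.2 hα hβ)).ne', hx'.1⟩
  simpa [ht.not_ge] using measure_mono_null hsub h

theorem ae_betaMeasure_mem_Ioo (α β : ℝ) : ∀ᵐ x ∂betaMeasure α β, x ∈ Set.Ioo (0 : ℝ) 1 := by
  rw [betaMeasure, ae_withDensity_iff (measurable_betaPDF α β)]
  refine ae_of_all _ fun x hx => ?_
  by_contra h
  exact hx (by rw [betaPDF_eq, if_neg (by exact h), ENNReal.ofReal_zero])

theorem integral_betaMeasure (hα : 0 < α) (hβ : 0 < β) (f : ℝ → ℝ) :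
    ∫ x, f x ∂betaMeasure α β = ∫ x, betaPDFReal α β x * f x := by
  have hnonneg (x : ℝ) : 0 ≤ betaPDFReal α β x := by
    by_cases h : 0 < x ∧ x < 1
    · exact (betaPDFReal_pos h.1 h.2 hα hβ).le
    · simp [betaPDFReal, h]
  rw [betaMeasure, integral_withDensity_eq_integral_toReal_smul (measurable_betaPDF α β)
    (ae_of_all _ fun _ => ENNReal.ofReal_lt_top)]
  simp only [betaPDF, ENNReal.toReal_ofReal (hnonneg _), smul_eq_mul]

theorem betaPDFReal_mul_self (hα : 0 < α) (hβ : 0 < β) (x : ℝ) :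
    betaPDFReal α β x * x = α / (α + β) * betaPDFReal (α + 1) β x := by
  by_cases h : 0 < x ∧ x < 1
  · have hαβ := (add_pos hα hβ).ne'
    have hbeta := (beta_pos hα hβ).ne'
    simp only [betaPDFReal, h, and_self, if_true, beta_add_one_left hα hβ, add_sub_right_comm α 1 1,
      Real.rpow_add_one h.1.ne']
    field_simp
  · simp [betaPDFReal, h]

theorem integral_mul_betaMeasure (hα : 0 < α) (hβ : 0 < β) (f : ℝ → ℝ) :
    ∫ x, x * f x ∂betaMeasure α β = α / (α + β) * ∫ x, f x ∂betaMeasure (α + 1) β := by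
  rw [integral_betaMeasure hα hβ, integral_betaMeasure (by linarith) hβ, ← integral_const_mul]
  simp only [← mul_assoc, betaPDFReal_mul_self hα hβ]

theorem integral_id_betaMeasure (hα : 0 < α) (hβ : 0 < β) :
    ∫ x, x ∂betaMeasure α β = α / (α + β) := by
  have := isProbabilityMeasureBeta (add_pos hα one_pos) hβ
  simpa using integral_mul_betaMeasure hα hβ fun _ => 1

theorem memLp_id_betaMeasure (hα : 0 < α) (hβ : 0 < β) (p : ENNReal) :
    MemLp id p (betaMeasure α β) := by
  have := isProbabilityMeasureBeta hα hβ
  refine MemLp.of_bound aestronglyMeasurable_id 1 ?_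
  filter_upwards [ae_betaMeasure_mem_Ioo α β] with x hx
  exact (Real.norm_of_nonneg hx.1.le).trans_le hx.2.le

theorem variance_id_betaMeasure (hα : 0 < α) (hβ : 0 < β) :
    Var[id; betaMeasure α β] = α * β / ((α + β) ^ 2 * (α + β + 1)) := by
  have := isProbabilityMeasureBeta hα hβ
  have hsq := integral_mul_betaMeasure hα hβ id
  simp only [id, integral_id_betaMeasure (add_pos hα one_pos) hβ, ← sq] at hsq
  rw [variance_eq_sub (memLp_id_betaMeasure hα hβ 2)]
  simp only [Pi.pow_apply, id, hsq, integral_id_betaMeasure hα hβ, add_right_comm α 1 β]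
  field_simp
  ring

theorem betaMeasure_real_Iio_le (hα : 0 < α) (hβ : 0 < β) {t : ℝ} (ht : (α + β) * t < α) :
    (betaMeasure α β).real (Set.Iio t) ≤ α / (α - (α + β) * t) ^ 2 := by
  have := isProbabilityMeasureBeta hα hβ
  have hαβ := add_pos hα hβ
  have hdev : 0 < α / (α + β) - t := sub_pos.2 ((lt_div_iff₀' hαβ).2 ht)
  have hsub : Set.Iio t ⊆ {x | α / (α + β) - t ≤ |id x - ∫ x, id x ∂betaMeasure α β|} := by
    intro x hx
    simp only [Set.mem_ofPred_eq, id, integral_id_betaMeasure hα hβ]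
    exact le_abs.2 (.inr (by linarith [Set.mem_Iio.1 hx]))
  calc (betaMeasure α β).real (Set.Iio t)
      ≤ Var[id; betaMeasure α β] / (α / (α + β) - t) ^ 2 :=
        ENNReal.toReal_le_of_le_ofReal (div_nonneg (variance_nonneg _ _) (sq_nonneg _))
          ((measure_mono hsub).trans
            (meas_ge_le_variance_div_sq (memLp_id_betaMeasure hα hβ 2) hdev))
    _ = β / (α + β + 1) * (α / (α - (α + β) * t) ^ 2) := by
        have hdev' : α - (α + β) * t ≠ 0 := (sub_pos.2 ht).ne'
        rw [variance_id_betaMeasure hα hβ, div_sub' hαβ.ne']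
        field_simp
    _ ≤ α / (α - (α + β) * t) ^ 2 :=
        mul_le_of_le_one_left (by positivity) ((div_le_one (by linarith)).2 (by linarith))

end Beta

section OrderStatistics

variable {n : ℕ}

theorem monotone_orderStat_index (x : Fin n → ℝ) : Monotone (orderStat x) :=
  Tuple.monotone_sort x

theorem orderStat_le_iff (x : Fin n → ℝ) (k : Fin n) (t : ℝ) :
    orderStat x k ≤ t ↔ (k : ℝ) < count (Set.Iic t) x := by
  rw [← Tuple.lt_card_le_iff_apply_le_of_monotone (monotone_orderStat_index x),
    ← Fintype.card_subtype, count_eq_card, Nat.cast_lt]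
  have hcard : Fintype.card {i // orderStat x i ≤ t} = Fintype.card {i // x i ∈ Set.Iic t} :=
    Fintype.card_congr ((Tuple.sort x).subtypeEquiv fun _ => Iff.rfl)
  rw [hcard]

theorem monotone_orderStat (k : Fin n) : Monotone fun x => orderStat x k := fun x y h =>
  (orderStat_le_iff x k _).2 <| ((orderStat_le_iff y k _).1 le_rfl).trans_le <|
    count_le_count fun i => (h i).trans

theorem measurable_orderStat (k : Fin n) : Measurable fun x => orderStat x k := by
  refine measurable_of_Iic fun t => ?_
  simp only [Set.preimage, Set.mem_Iic, orderStat_le_iff]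
  exact measurableSet_lt measurable_const (measurable_count measurableSet_Iic)

theorem orderStat_eq_of_monotone {x : Fin n → ℝ} {σ : Equiv.Perm (Fin n)} (h : Monotone (x ∘ σ))
    (k : Fin n) : orderStat x k = x (σ k) :=
  (congrFun (Tuple.comp_sort_eq_comp_iff_monotone.2 h) k).symm

theorem orderStat_comp_monotone {f : ℝ → ℝ} (hf : Monotone f) (x : Fin n → ℝ) (k : Fin n) :
    orderStat (fun i => f (x i)) k = f (orderStat x k) :=
  orderStat_eq_of_monotone (x := fun i => f (x i)) (hf.comp (monotone_orderStat_index x)) k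

theorem orderStat_one_sub (x : Fin n → ℝ) (k : Fin n) :
    orderStat (fun i => 1 - x i) k = 1 - orderStat x k.rev :=
  orderStat_eq_of_monotone (x := fun i => 1 - x i) (σ := Fin.revPerm.trans (Tuple.sort x))
    (fun _ _ hij => sub_le_sub_left (monotone_orderStat_index x (Fin.rev_le_rev.2 hij)) 1) k

end OrderStatistics

section Statistics

variable {n : ℕ}

theorem natCast_sub_fin_pos (k : Fin n) : 0 < (n : ℝ) - k :=
  sub_pos.2 (Nat.cast_lt.2 k.2)

theorem monotone_pValue_id (k : Fin n) : Monotone fun x => pValue id x k :=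
  (monotone_betaMeasure_real_Iio k.val.cast_add_one_pos (natCast_sub_fin_pos k)).comp
    (monotone_orderStat k)

theorem measurable_pValue_id (k : Fin n) : Measurable fun x => pValue id x k :=
  (monotone_betaMeasure_real_Iio k.val.cast_add_one_pos
    (natCast_sub_fin_pos k)).measurable.comp (measurable_orderStat k)

theorem pValue_id_comp_monotone {F : ℝ → ℝ} (hF : Monotone F) (x : Fin n → ℝ) (k : Fin n) :
    pValue id (fun i => F (x i)) k = pValue F x k := by
  simp only [pValue, orderStat_comp_monotone hF, id]

theorem pValue_id_one_sub (x : Fin n → ℝ) (k : Fin n) :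
    pValue id (fun i => 1 - x i) k = 1 - pValue id x k.rev := by
  have hk : ((k.rev : ℕ) : ℝ) = n - (k + 1) := by
    rw [Fin.val_rev, Nat.cast_sub k.2, Nat.cast_add_one]
  rw [pValue, pValue, hk, id, id, orderStat_one_sub, sub_sub_cancel, ← sub_sub, sub_add_cancel,
    betaMeasure_real_Iio_one_sub k.val.cast_add_one_pos (natCast_sub_fin_pos k)]

theorem Mplus_id_one_sub (x : Fin n → ℝ) : Mplus id (fun i => 1 - x i) = Mminus id x := by
  simp only [Mplus, Mminus, pValue_id_one_sub]
  exact Fin.revPerm.iInf_comp (g := fun k => 1 - pValue id x k)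

theorem Mplus_id_comp_monotone {F : ℝ → ℝ} (hF : Monotone F) (x : Fin n → ℝ) :
    Mplus id (fun i => F (x i)) = Mplus F x := by
  simp only [Mplus, pValue_id_comp_monotone hF]

theorem M_id_comp_monotone {F : ℝ → ℝ} (hF : Monotone F) (x : Fin n → ℝ) :
    M id (fun i => F (x i)) = M F x := by
  simp only [M, Mplus, Mminus, pValue_id_comp_monotone hF]

theorem monotone_Mplus_id : Monotone (Mplus id : (Fin n → ℝ) → ℝ) :=
  fun _ _ h => ciInf_mono (Set.finite_range _).bddBelow fun k => monotone_pValue_id k h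

theorem antitone_Mminus_id : Antitone (Mminus id : (Fin n → ℝ) → ℝ) := fun _ _ h =>
  ciInf_mono (Set.finite_range _).bddBelow fun k => sub_le_sub_left (monotone_pValue_id k h) 1

theorem measurable_Mplus_id : Measurable (Mplus id : (Fin n → ℝ) → ℝ) :=
  Measurable.iInf measurable_pValue_id

theorem measurable_Mminus_id : Measurable (Mminus id : (Fin n → ℝ) → ℝ) :=
  Measurable.iInf fun k => measurable_const.sub (measurable_pValue_id k)

theorem measurable_M_id : Measurable (M id : (Fin n → ℝ) → ℝ) :=
  measurable_Mplus_id.min measurable_Mminus_id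

theorem Mplus_id_pos [NeZero n] {x : Fin n → ℝ} (hx : ∀ i, 0 < x i) : 0 < Mplus id x := by
  obtain ⟨k, hk⟩ := exists_eq_ciInf_of_finite (f := fun k => pValue id x k)
  rw [Mplus, ← hk]
  exact betaMeasure_real_Iio_pos k.val.cast_add_one_pos (natCast_sub_fin_pos k) (hx _)

theorem Mplus_id_le_of_lt_count {t : ℝ} {x : Fin n → ℝ} (ht : 0 ≤ t)
    (hx : (n + 1) * t < count (Set.Iic t) x) :
    Mplus id x ≤ count (Set.Iic t) x / (count (Set.Iic t) x - (n + 1) * t) ^ 2 := by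
  classical
  have hpos : 0 < Fintype.card {i // x i ∈ Set.Iic t} := by
    rw [← Nat.cast_pos (α := ℝ)]
    exact (hx.trans_eq (count_eq_card _ x)).trans_le' (by positivity)
  have hcard := (Fintype.card_subtype_le (x · ∈ Set.Iic t)).trans_eq (Fintype.card_fin n)
  let k : Fin n := ⟨Fintype.card {i // x i ∈ Set.Iic t} - 1, by omega⟩
  have hk : (k : ℝ) + 1 = count (Set.Iic t) x := by
    rw [count_eq_card, ← Nat.cast_add_one, Nat.sub_add_cancel hpos]
  have hsum : (k : ℝ) + 1 + (n - k) = n + 1 := by ring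
  rw [← hk] at hx ⊢
  calc Mplus id x ≤ pValue id x k := ciInf_le (Set.finite_range _).bddBelow k
    _ ≤ (betaMeasure (k + 1) (n - k)).real (Set.Iio t) :=
        monotone_betaMeasure_real_Iio k.val.cast_add_one_pos (natCast_sub_fin_pos k)
          ((orderStat_le_iff x k t).2 (by rw [← hk]; exact lt_add_one _))
    _ ≤ _ := by
        rw [← hsum] at hx ⊢
        exact betaMeasure_real_Iio_le k.val.cast_add_one_pos (natCast_sub_fin_pos k) hx

theorem Mplus_id_le_of_le_count {t T : ℝ} {x : Fin n → ℝ} (hT : 1 ≤ T) (ht : t ≤ 1)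
    (hnt : 1 ≤ n * t) (hx : n * t + (T + 1) * √(n * t) ≤ count (Set.Iic t) x) :
    Mplus id x ≤ 3 / T := by
  have hs : 1 ≤ √(n * t) := Real.one_le_sqrt.2 hnt
  have hsq : √(n * t) ^ 2 = n * t := Real.sq_sqrt (by linarith)
  have ht0 : 0 ≤ t := (pos_of_mul_pos_right (one_pos.trans_le hnt) n.cast_nonneg).le
  set D := count (Set.Iic t) x - (n + 1) * t with hD
  have hDs : T * √(n * t) ≤ D := by linarith
  have hT0 : 0 < T := one_pos.trans_le hT
  have hDT : T ≤ D := (le_mul_of_one_le_right hT0.le hs).trans hDs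
  have hD0 : 0 < D := hT0.trans_le hDT
  have hcount : count (Set.Iic t) x ≤ D + 2 * √(n * t) ^ 2 := by linarith
  refine (Mplus_id_le_of_lt_count ht0 (by linarith)).trans ?_
  rw [← hD, div_le_div_iff₀ (by positivity) (by positivity)]
  calc count (Set.Iic t) x * T
      ≤ (D + 2 * √(n * t) ^ 2) * T := by gcongr
    _ ≤ D * T + 2 * (T * √(n * t)) ^ 2 := by
        rw [mul_pow, add_mul, mul_assoc, mul_comm (√(n * t) ^ 2)]
        gcongr
        exact le_self_pow₀ hT two_ne_zero
    _ ≤ D * D + 2 * D ^ 2 := by gcongr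
    _ = 3 * D ^ 2 := by ring

end Statistics

section Bounds

variable {n : ℕ} {μ : Measure ℝ} [IsProbabilityMeasure μ]

theorem measureReal_pi_Mminus_id_le (hμ : MeasurePreserving (fun x => 1 - x) μ μ) (c : ℝ) :
    (Measure.pi fun _ : Fin n => μ).real {x | Mminus id x ≤ c} =
      (Measure.pi fun _ : Fin n => μ).real {x | Mplus id x ≤ c} := by
  rw [← (measurePreserving_pi _ _ fun _ : Fin n => hμ).measureReal_preimage
    (measurableSet_le measurable_Mplus_id measurable_const).nullMeasurableSet]
  simp only [Set.preimage_ofPred_eq, Mplus_id_one_sub]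

theorem measureReal_pi_M_id_le (hμ : MeasurePreserving (fun x => 1 - x) μ μ) (c : ℝ) :
    (Measure.pi fun _ : Fin n => μ).real {x | M id x ≤ c} =
      2 * (Measure.pi fun _ : Fin n => μ).real {x | Mplus id x ≤ c} -
        (Measure.pi fun _ : Fin n => μ).real ({x | Mplus id x ≤ c} ∩ {x | Mminus id x ≤ c}) := by
  have hunion := measureReal_union_add_inter (μ := Measure.pi fun _ : Fin n => μ)
    (s := {x | Mplus id x ≤ c}) (measurableSet_le measurable_Mminus_id (measurable_const (a := c)))
  rw [measureReal_pi_Mminus_id_le hμ] at hunion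
  rw [two_mul, ← hunion, add_sub_cancel_right]
  simp only [M, min_le_iff, Set.ofPred_or]

theorem measureReal_pi_Mplus_inter_Mminus_le (hμ : MeasurePreserving (fun x => 1 - x) μ μ)
    (c : ℝ) :
    (Measure.pi fun _ : Fin n => μ).real ({x | Mplus id x ≤ c} ∩ {x | Mminus id x ≤ c}) ≤
      (Measure.pi fun _ : Fin n => μ).real {x | Mplus id x ≤ c} ^ 2 := by
  have hinter := ((PositivelyAssociated.of_linearOrder (μ := μ)).pi n).measureReal_inter_le
    (s := {x | Mplus id x ≤ c}) (t := {x | Mminus id x ≤ c})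
    (fun x y h hx => (monotone_Mplus_id h).trans hx)
    (fun x y h hx => (antitone_Mminus_id h).trans hx)
    (measurableSet_le measurable_Mplus_id measurable_const)
    (measurableSet_le measurable_Mminus_id measurable_const)
  rwa [measureReal_pi_Mminus_id_le hμ, ← sq] at hinter

theorem le_measureReal_pi_M_id_le (hμ : MeasurePreserving (fun x => 1 - x) μ μ) (c : ℝ) :
    2 * (Measure.pi fun _ : Fin n => μ).real {x | Mplus id x ≤ c} -
      (Measure.pi fun _ : Fin n => μ).real {x | Mplus id x ≤ c} ^ 2 ≤
        (Measure.pi fun _ : Fin n => μ).real {x | M id x ≤ c} := by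
  rw [measureReal_pi_M_id_le hμ]
  exact sub_le_sub_left (measureReal_pi_Mplus_inter_Mminus_le hμ c) _

theorem measureReal_pi_M_id_le_two_mul (hμ : MeasurePreserving (fun x => 1 - x) μ μ) (c : ℝ) :
    (Measure.pi fun _ : Fin n => μ).real {x | M id x ≤ c} ≤
      2 * (Measure.pi fun _ : Fin n => μ).real {x | Mplus id x ≤ c} := by
  rw [measureReal_pi_M_id_le hμ]
  exact sub_le_self _ measureReal_nonneg

end Bounds

section Uniform

/-- The uniform distribution on the unit interval, as a measure on `ℝ`. -/
def stdUniform : Measure ℝ := volume.restrict (Set.Icc 0 1)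

instance isProbabilityMeasure_stdUniform : IsProbabilityMeasure stdUniform :=
  ⟨by simp [stdUniform]⟩

theorem stdUniform_Iic (a : ℝ) : stdUniform (Set.Iic a) = ENNReal.ofReal (min a 1) := by
  rw [stdUniform, Measure.restrict_apply measurableSet_Iic, Set.inter_comm, ← Set.Ici_inter_Iic,
    Set.inter_assoc, Set.Iic_inter_Iic, Set.Ici_inter_Iic, Real.volume_Icc, sub_zero, min_comm]

theorem stdUniform_real_Iic {a : ℝ} (h0 : 0 ≤ a) (h1 : a ≤ 1) :
    stdUniform.real (Set.Iic a) = a := by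
  rw [measureReal_def, stdUniform_Iic, min_eq_left h1, ENNReal.toReal_ofReal h0]

theorem stdUniform_real_Ioc {a b : ℝ} (h0 : 0 ≤ a) (hab : a ≤ b) (h1 : b ≤ 1) :
    stdUniform.real (Set.Ioc a b) = b - a := by
  rw [← Set.Iic_sdiff_Iic, measureReal_sdiff (Set.Iic_subset_Iic.2 hab) measurableSet_Iic,
    stdUniform_real_Iic (h0.trans hab) h1, stdUniform_real_Iic h0 (hab.trans h1)]

theorem ae_stdUniform_pos : ∀ᵐ x ∂stdUniform, 0 < x := by
  simp only [ae_iff, not_lt]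
  exact (stdUniform_Iic 0).trans (by simp)

theorem measurePreserving_one_sub_stdUniform :
    MeasurePreserving (fun x => 1 - x) stdUniform stdUniform := by
  have h := (Measure.measurePreserving_sub_left volume (1 : ℝ)).restrict_preimage
    (measurableSet_Icc (a := 0) (b := 1))
  rwa [Set.preimage_const_sub_Icc, sub_self, sub_zero] at h

theorem measureReal_Mplus_id_le_zero (n : ℕ) [NeZero n] :
    (Measure.pi fun _ : Fin n => stdUniform).real {x | Mplus id x ≤ 0} = 0 := by
  have hpos : ∀ᵐ x ∂Measure.pi fun _ : Fin n => stdUniform, ∀ i, 0 < x i := ae_all_iff.2 fun i =>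
    (measurePreserving_eval _ i).quasiMeasurePreserving.ae ae_stdUniform_pos
  rw [measureReal_eq_zero_iff, ← compl_mem_ae_iff]
  exact hpos.mono fun x hx => (Mplus_id_pos hx).not_ge

end Uniform

section ProbabilityIntegralTransform

variable {ν : Measure ℝ}

theorem exists_cdf_eq (hF : Continuous (cdf ν)) {a : ℝ} (h0 : 0 < a) (h1 : a < 1) :
    ∃ x, cdf ν x = a :=
  mem_range_of_exists_le_of_exists_ge hF
    (((tendsto_cdf_atBot ν).eventually_lt_const h0).exists.imp fun _ => le_of_lt)
    (((tendsto_cdf_atTop ν).eventually_const_lt h1).exists.imp fun _ => le_of_lt)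

variable [IsProbabilityMeasure ν]

theorem measure_cdf_le_le (hF : Continuous (cdf ν)) {a : ℝ} (h0 : 0 ≤ a) (h1 : a < 1) :
    ν {x | cdf ν x ≤ a} ≤ ENNReal.ofReal a := by
  have hlim : Tendsto ENNReal.ofReal (𝓝[>] a) (𝓝 (ENNReal.ofReal a)) :=
    ENNReal.continuous_ofReal.continuousAt.tendsto.mono_left nhdsWithin_le_nhds
  refine ge_of_tendsto hlim (eventually_of_mem (Ioo_mem_nhdsGT h1) fun b hb => ?_)
  obtain ⟨x, rfl⟩ := exists_cdf_eq hF (h0.trans_lt hb.1) hb.2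
  rw [ofReal_cdf]
  exact measure_mono fun y hy => ((monotone_cdf ν).reflect_lt (hy.trans_lt hb.1)).le

theorem le_measure_cdf_le (hF : Continuous (cdf ν)) {a : ℝ} (h1 : a < 1) :
    ENNReal.ofReal a ≤ ν {x | cdf ν x ≤ a} := by
  rcases le_or_gt a 0 with h0 | h0
  · simp [ENNReal.ofReal_of_nonpos h0]
  · obtain ⟨x, rfl⟩ := exists_cdf_eq hF h0 h1
    rw [ofReal_cdf]
    exact measure_mono fun y hy => monotone_cdf ν hy

theorem measurePreserving_cdf (hF : Continuous (cdf ν)) :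
    MeasurePreserving (cdf ν) ν stdUniform := by
  have := Measure.isProbabilityMeasure_map (μ := ν) hF.aemeasurable
  refine ⟨hF.measurable, Measure.ext_of_Iic _ _ fun a => ?_⟩
  rw [Measure.map_apply hF.measurable measurableSet_Iic, stdUniform_Iic]
  change ν {x | cdf ν x ≤ a} = _
  rcases lt_or_ge a 0 with h0 | h0
  · simp [(h0.trans_le (cdf_nonneg ν _)).not_ge, ENNReal.ofReal_of_nonpos,
      (min_le_left a 1).trans h0.le]
  rcases lt_or_ge a 1 with h1 | h1
  · rw [min_eq_left h1.le]
    exact (measure_cdf_le_le hF h0 h1).antisymm (le_measure_cdf_le hF h1)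
  · simp [(cdf_le_one ν _).trans h1, h1]

variable {Ω : Type*} [MeasurableSpace Ω] {P : Measure Ω} {n : ℕ} {X : Fin n → Ω → ℝ}

theorem NullSample.hasLaw_cdf (hX : NullSample ν P X) (hF : Continuous (cdf ν)) :
    HasLaw (fun ω i => cdf ν (X i ω)) (Measure.pi fun _ => stdUniform) P :=
  (hX.indep.comp _ fun _ => hF.measurable).hasLaw_pi
    fun i => (measurePreserving_cdf hF).comp_hasLaw (hX.hasLaw i)

theorem NullSample.measureReal_Mplus_le (hX : NullSample ν P X) (hF : Continuous (cdf ν)) (c : ℝ) :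
    P.real {ω | Mplus (cdf ν) (fun i => X i ω) ≤ c} =
      (Measure.pi fun _ : Fin n => stdUniform).real {x | Mplus id x ≤ c} := by
  simp only [← (hX.hasLaw_cdf hF).measureReal_eq
    (measurableSet_le measurable_Mplus_id measurable_const),
    Mplus_id_comp_monotone (monotone_cdf ν)]

theorem NullSample.measureReal_M_le (hX : NullSample ν P X) (hF : Continuous (cdf ν)) (c : ℝ) :
    P.real {ω | M (cdf ν) (fun i => X i ω) ≤ c} =
      (Measure.pi fun _ : Fin n => stdUniform).real {x | M id x ≤ c} := by
  simp only [← (hX.hasLaw_cdf hF).measureReal_eq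
    (measurableSet_le measurable_M_id measurable_const), M_id_comp_monotone (monotone_cdf ν)]

end ProbabilityIntegralTransform

section Windows

/-- The windows `(r ^ (j + 2), r ^ (j + 1)]`, whose counts of observations serve, for small `r`,
as nearly independent tests of an excess of small observations. -/
def window (r : ℝ) (j : ℕ) : Set ℝ := Set.Ioc (r ^ (j + 2)) (r ^ (j + 1))

variable {r : ℝ}

theorem measurableSet_window (r : ℝ) (j : ℕ) : MeasurableSet (window r j) :=
  measurableSet_Ioc

theorem pairwise_disjoint_window (h0 : 0 ≤ r) (h1 : r ≤ 1) :
    Pairwise (Function.onFun Disjoint (window r)) :=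
  Antitone.pairwise_disjoint_on_Ioc_succ (f := fun j => r ^ (j + 1)) fun _ _ h =>
    pow_le_pow_of_le_one h0 h1 (Nat.add_le_add_right h 1)

theorem stdUniform_real_window (h0 : 0 ≤ r) (h1 : r ≤ 1) (j : ℕ) :
    stdUniform.real (window r j) = (1 - r) * r ^ (j + 1) := by
  rw [window, stdUniform_real_Ioc (by positivity)
    (pow_le_pow_of_le_one h0 h1 (Nat.le_succ _)) (pow_le_one₀ h0 h1), pow_succ' r (j + 1),
    sub_mul, one_mul]

theorem stdUniform_real_window_mem_Ioo (h0 : 0 < r) (h1 : r < 1) (j : ℕ) :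
    stdUniform.real (window r j) ∈ Set.Ioo (0 : ℝ) 1 := by
  rw [stdUniform_real_window h0.le h1.le]
  exact ⟨mul_pos (sub_pos.2 h1) (pow_pos h0 _), mul_lt_one_of_nonneg_of_lt_one_left
    (sub_nonneg.2 h1.le) (sub_lt_self 1 h0) (pow_le_one₀ h0.le h1.le)⟩

theorem le_variance_window (h0 : 0 ≤ r) (h1 : r ≤ 1 / 2) (j : ℕ) :
    r ^ (j + 1) / 4 ≤ stdUniform.real (window r j) * (1 - stdUniform.real (window r j)) := by
  have ht0 : 0 ≤ r ^ (j + 1) := pow_nonneg h0 _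
  have ht : r ^ (j + 1) ≤ 1 / 2 := (pow_le_of_le_one h0 (by linarith) j.succ_ne_zero).trans h1
  have hlow : r ^ (j + 1) / 2 ≤ stdUniform.real (window r j) := by
    rw [stdUniform_real_window h0 (by linarith)]
    nlinarith
  have hupp : stdUniform.real (window r j) ≤ 1 / 2 := by
    rw [stdUniform_real_window h0 (by linarith)]
    nlinarith
  calc r ^ (j + 1) / 4 = r ^ (j + 1) / 2 * (1 / 2) := by ring
    _ ≤ _ := mul_le_mul hlow (by linarith) (by norm_num) measureReal_nonneg

/-- The event that the standardized number of observations in the `j`-th window is below `y`. -/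
def windowDeficit {n : ℕ} (r y : ℝ) (j : ℕ) : Set (Fin n → ℝ) :=
  {x | count (window r j) x < n * stdUniform.real (window r j) +
    y * √(n * (stdUniform.real (window r j) * (1 - stdUniform.real (window r j))))}

theorem Mplus_id_le_of_notMem_windowDeficit {n : ℕ} {T : ℝ} {j : ℕ} {x : Fin n → ℝ} (h0 : 0 ≤ r)
    (h1 : r ≤ 1 / 2) (hT : 1 ≤ T) (hn : 1 ≤ n * r ^ (j + 1))
    (hbelow : n * r ^ (j + 2) - √(n * r ^ (j + 1)) ≤ count (Set.Iic (r ^ (j + 2))) x)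
    (hwindow : x ∉ windowDeficit r (2 * (T + 2)) j) :
    Mplus id x ≤ 3 / T := by
  have h1' : r ≤ 1 := by linarith
  have hcount : count (Set.Iic (r ^ (j + 1))) x =
      count (Set.Iic (r ^ (j + 2))) x + count (window r j) x := by
    rw [window, ← count_union (Set.Iic_disjoint_Ioc le_rfl),
      Set.Iic_union_Ioc_eq_Iic (pow_le_pow_of_le_one h0 h1' (Nat.le_succ _))]
  have hsd : √(n * r ^ (j + 1)) ≤
      2 * √(n * (stdUniform.real (window r j) * (1 - stdUniform.real (window r j)))) := by
    rw [Real.sqrt_le_left (by positivity), mul_pow, Real.sq_sqrt]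
    · nlinarith [le_variance_window h0 h1 j, n.cast_nonneg (α := ℝ)]
    · exact mul_nonneg n.cast_nonneg ((by positivity : 0 ≤ r ^ (j + 1) / 4).trans
        (le_variance_window h0 h1 j))
  refine Mplus_id_le_of_le_count hT (pow_le_one₀ h0 h1') hn ?_
  rw [windowDeficit, Set.mem_ofPred_eq, not_lt] at hwindow
  rw [stdUniform_real_window h0 h1'] at hwindow hsd
  have hsd' := mul_le_mul_of_nonneg_left hsd (by linarith : 0 ≤ T + 2)
  have hpow : n * r ^ (j + 1) = n * r ^ (j + 2) + n * ((1 - r) * r ^ (j + 1)) := by ring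
  linarith

theorem measureReal_count_Iic_pow_le {n : ℕ} {j : ℕ} (h0 : 0 ≤ r) (h1 : r ≤ 1)
    (hn : 0 < n * r ^ (j + 1)) :
    (Measure.pi fun _ : Fin n => stdUniform).real
      {x | count (Set.Iic (r ^ (j + 2))) x ≤ n * r ^ (j + 2) - √(n * r ^ (j + 1))} ≤ r := by
  have hreal : stdUniform.real (Set.Iic (r ^ (j + 2))) = r ^ (j + 2) :=
    stdUniform_real_Iic (by positivity) (pow_le_one₀ h0 h1)
  have hcheb := measureReal_count_le_sub (μ := stdUniform)
    (measurableSet_Iic (a := r ^ (j + 2))) n (Real.sqrt_pos.2 hn)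
  rw [hreal, Real.sq_sqrt hn.le] at hcheb
  refine hcheb.trans ((div_le_iff₀ hn).2 ?_)
  calc n * (r ^ (j + 2) * (1 - r ^ (j + 2))) ≤ n * (r ^ (j + 2) * 1) := by
        gcongr
        exact sub_le_self _ (by positivity)
    _ = r * (n * r ^ (j + 1)) := by ring

theorem measureReal_lt_Mplus_id_le {n K : ℕ} {T : ℝ} (h0 : 0 ≤ r) (h1 : r ≤ 1 / 2) (hT : 1 ≤ T)
    (hn : 1 ≤ n * r ^ K) :
    (Measure.pi fun _ : Fin n => stdUniform).real {x | 3 / T < Mplus id x} ≤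
      (∏ j : Fin K, (Measure.pi fun _ : Fin n => stdUniform).real
        (windowDeficit r (2 * (T + 2)) j)) + K * r := by
  have h1' : r ≤ 1 := by linarith
  have hnj (j : Fin K) : 1 ≤ n * r ^ (j + 1 : ℕ) :=
    hn.trans (mul_le_mul_of_nonneg_left (pow_le_pow_of_le_one h0 h1' j.2) n.cast_nonneg)
  let below (j : Fin K) : Set (Fin n → ℝ) :=
    {x | count (Set.Iic (r ^ (j + 2 : ℕ))) x ≤ n * r ^ (j + 2 : ℕ) - √(n * r ^ (j + 1 : ℕ))}
  have hsub : {x : Fin n → ℝ | 3 / T < Mplus id x} ⊆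
      {x | ∀ j : Fin K, x ∈ windowDeficit r (2 * (T + 2)) j} ∪ ⋃ j, below j := by
    intro x hx
    by_contra! hx'
    rw [Set.mem_union, Set.mem_ofPred_eq, Set.mem_iUnion, not_or, not_forall, not_exists] at hx'
    obtain ⟨⟨j, hj⟩, hbelow⟩ := hx'
    exact hx.not_ge
      (Mplus_id_le_of_notMem_windowDeficit h0 h1 hT (hnj j) (not_le.1 (hbelow j)).le hj)
  refine (measureReal_mono hsub).trans ((measureReal_union_le _ _).trans (add_le_add ?_ ?_))
  · exact measureReal_forall_count_lt_le (I := fun j : Fin K => window r j)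
      (fun j => measurableSet_window r j)
      ((pairwise_disjoint_window h0 h1').comp_of_injective Fin.val_injective) _
  · calc _ ≤ ∑ j, (Measure.pi fun _ : Fin n => stdUniform).real (below j) :=
          measureReal_iUnion_fintype_le _
      _ ≤ ∑ _ : Fin K, r := Finset.sum_le_sum fun j _ =>
          measureReal_count_Iic_pow_le h0 h1' (one_pos.trans_le (hnj j))
      _ = K * r := by simp

theorem tendsto_prod_measureReal_windowDeficit (h0 : 0 < r) (h1 : r < 1) (y : ℝ) (K : ℕ) :
    Tendsto (fun n => ∏ j : Fin K,
        (Measure.pi fun _ : Fin n => stdUniform).real (windowDeficit r y j))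
      atTop (𝓝 ((gaussianReal 0 1).real (Set.Iio y) ^ K)) := by
  have hwindow (j : ℕ) := stdUniform_real_window_mem_Ioo h0 h1 j
  have hprod := tendsto_finsetProd (Finset.univ : Finset (Fin K)) fun j _ =>
    tendsto_measureReal_count_lt (measurableSet_window r j) (hwindow j).1 (hwindow j).2 y
  rwa [Finset.prod_const, Finset.card_univ, Fintype.card_fin] at hprod

theorem tendsto_measureReal_lt_Mplus_id {c : ℝ} (hc : 0 < c) :
    Tendsto (fun n => (Measure.pi fun _ : Fin n => stdUniform).real {x | c < Mplus id x}) atTop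
      (𝓝 0) := by
  refine tendsto_order.2 ⟨fun a ha => .of_forall fun _ => ha.trans_le measureReal_nonneg,
    fun ε hε => ?_⟩
  set T := max 1 (3 / c)
  have hT : 1 ≤ T := le_max_left _ _
  have hTc : 3 / T ≤ c := (div_le_comm₀ (by positivity) hc).2 (le_max_right _ _)
  set φ := (gaussianReal 0 1).real (Set.Iio (2 * (T + 2)))
  obtain ⟨K, hK⟩ : ∃ K : ℕ, φ ^ K < ε / 2 :=
    exists_pow_lt_of_lt_one (half_pos hε) (gaussianReal_real_Iio_lt_one 0 one_ne_zero _)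
  have hKr : Tendsto (fun r : ℝ => K * r) (𝓝[>] 0) (𝓝 0) :=
    ((continuous_const_mul (K : ℝ)).tendsto' 0 0 (mul_zero _)).mono_left nhdsWithin_le_nhds
  obtain ⟨r, hKr, hr0, hr1⟩ := ((hKr.eventually_lt_const (half_pos hε)).and
    (Ioc_mem_nhdsGT one_half_pos)).exists
  have hprod := tendsto_prod_measureReal_windowDeficit hr0 (by linarith) (2 * (T + 2)) K
  have hlarge : ∀ᶠ n : ℕ in atTop, 1 ≤ n * r ^ K :=
    (tendsto_natCast_atTop_atTop.atTop_mul_const (pow_pos hr0 K)).eventually_ge_atTop 1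
  filter_upwards [hprod.eventually_lt_const hK, hlarge] with n hn hnK
  calc _ ≤ (Measure.pi fun _ : Fin n => stdUniform).real {x | 3 / T < Mplus id x} :=
        measureReal_mono fun x hx => hTc.trans_lt hx
    _ ≤ _ := measureReal_lt_Mplus_id_le hr0.le hr1 hT hnK
    _ < ε := by linarith

theorem tendsto_measureReal_Mplus_id_le {c : ℝ} (hc : 0 < c) :
    Tendsto (fun n => (Measure.pi fun _ : Fin n => stdUniform).real {x | Mplus id x ≤ c}) atTop
      (𝓝 1) := by
  have h (n : ℕ) : (Measure.pi fun _ : Fin n => stdUniform).real {x | Mplus id x ≤ c} =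
      1 - (Measure.pi fun _ : Fin n => stdUniform).real {x | c < Mplus id x} := by
    rw [← probReal_compl_eq_one_sub (measurableSet_lt measurable_const measurable_Mplus_id)]
    simp only [Set.compl_ofPred, not_lt]
  simpa only [h, sub_zero] using (tendsto_measureReal_lt_Mplus_id hc).const_sub 1

end Windows

section Asymptotics

theorem tendsto_measureReal_M_id_le_sub {c : ℝ} (hc : 0 ≤ c) :
    Tendsto (fun n => (Measure.pi fun _ : Fin n => stdUniform).real {x | M id x ≤ c} -
      (2 * (Measure.pi fun _ : Fin n => stdUniform).real {x | Mplus id x ≤ c} -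
        (Measure.pi fun _ : Fin n => stdUniform).real {x | Mplus id x ≤ c} ^ 2)) atTop (𝓝 0) := by
  have hunif := measurePreserving_one_sub_stdUniform
  rcases hc.eq_or_lt with rfl | hc
  · refine tendsto_const_nhds.congr' ?_
    filter_upwards [eventually_ge_atTop 1] with n hn
    have : NeZero n := ⟨Nat.one_le_iff_ne_zero.1 hn⟩
    have hM := measureReal_pi_M_id_le_two_mul (n := n) hunif 0
    rw [measureReal_Mplus_id_le_zero] at hM ⊢
    linarith [measureReal_nonneg (μ := Measure.pi fun _ : Fin n => stdUniform)
      (s := {x | M id x ≤ 0})]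
  · have hq : Tendsto _ atTop (𝓝 ((1 - 1 : ℝ) ^ 2)) :=
      ((tendsto_measureReal_Mplus_id_le hc).const_sub 1).pow 2
    rw [sub_self, zero_pow two_ne_zero] at hq
    refine squeeze_zero (fun n => sub_nonneg.2 (le_measureReal_pi_M_id_le hunif c))
      (fun n => ?_) hq
    linarith [measureReal_le_one (μ := Measure.pi fun _ : Fin n => stdUniform)
      (s := {x | M id x ≤ c})]

end Asymptotics

end BerkJones

end

theorem theorem5
    -- the null distribution, with continuous distribution function
    (ν : Measure ℝ) [IsProbabilityMeasure ν] (hF : Continuous (cdf ν))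
    -- for every sample size `n`, a sample drawn under the null hypothesis
    {Ω : ℕ → Type*} [∀ n, MeasurableSpace (Ω n)] (P : ∀ n, Measure (Ω n))
    [∀ n, IsProbabilityMeasure (P n)] (X : ∀ n, Fin n → Ω n → ℝ)
    (hX : ∀ n, BerkJones.NullSample ν (P n) (X n))
    (c : ℝ) (hc : c ∈ Set.Icc (0 : ℝ) 1)
    -- `q n` is the null probability that `M_n^+ ≤ c`
    (q : ℕ → ℝ)
    (hq : ∀ n, q n = (P n).real {ω | BerkJones.Mplus (cdf ν) (fun i => X n i ω) ≤ c}) :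
    (∀ n : ℕ, 1 ≤ n →
      2 * q n - q n ^ 2 ≤ (P n).real {ω | BerkJones.M (cdf ν) (fun i => X n i ω) ≤ c} ∧
      (P n).real {ω | BerkJones.M (cdf ν) (fun i => X n i ω) ≤ c} ≤ 2 * q n) ∧
    Tendsto
      (fun n => (P n).real {ω | BerkJones.M (cdf ν) (fun i => X n i ω) ≤ c}
        - (2 * q n - q n ^ 2))
      atTop (𝓝 0) := by
  simp only [(hX _).measureReal_Mplus_le hF, (hX _).measureReal_M_le hF] at hq ⊢
  simp only [hq]
  have hunif := BerkJones.measurePreserving_one_sub_stdUniform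
  exact ⟨fun n _ => ⟨BerkJones.le_measureReal_pi_M_id_le hunif c,
    BerkJones.measureReal_pi_M_id_le_two_mul hunif c⟩,
    BerkJones.tendsto_measureReal_M_id_le_sub hc.1⟩
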